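/- **Conventions.** A left brace is a set $B$ with an abelian group structure $+$ and a group structure $\circ$ such that $a\circ(b+c)+a=a\circ b+a\circ c$ for all $a,b,c$; put $\lambda_a(b)=-a+a\circ b$. It is trivial if $\circ=+$. A solution $(X,r)$ (involutive, non-degenerate, set-theoretic solution of the Yang–Baxter equation) is a map $r(x,y)=(\sigma_x(y),\gamma_y(x))$ on $X^2$ with $r^2=\mathrm{id}$, all $\sigma_x,\gamma_y$ bijective and $r_{12}r_{23}r_{12}=r_{23}r_{12}r_{23}$. Its structure group is $G(X,r)=\langle x\in X\mid xy=\sigma_x(y)\gamma_y(x)\rangle$, with its natural left brace structure, in which $\lambda_x(y)=\sigma_x(y)$ for $x,y\in X$; its permutation group $\mathcal G(X,r)=\langle\sigma_x\mid x\in X\rangle\le \mathrm{Sym}_X$ carries the unique left brace structure for which $x\mapsto\sigma_x$ extends to a homomorphism of left braces $G(X,r)\to\mathcal G(X,r)$. If $H$ is an abelian group (a trivial brace), $S$ a left brace, $\alpha\colon(S,\circ)\to\mathrm{Aut}(H)$ a homomorphism and $b\colon H\times H\to (S,+)$ a symmetric bilinear map with $\lambda_s(b(f,h))=b(\alpha_s(f),\alpha_s(h))$,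 the asymmetric product $H\rtimes_\circ S$ is the left brace on $H\times S$ with $(f,s)\circ(h,u)=(f+\alpha_s(h),s\circ u)$ and $(f,s)+(h,u)=(f+h,s+u+b(f,h))$. **Setting.** Let $A$ be an abelian group, $t\in\mathrm{Aut}(A)$ with $t-\mathrm{id}$ invertible, $T=\langle t\rangle\le\mathrm{Aut}(A)$, and let $(j_a)_{a\in A}$ be a family of elements of $A$ with $j_{-a}=j_a$ and $j_{t^z(a)}=t^z(j_a)-(t^z-\mathrm{id})(j_0)$ for all $a\in A$, $z\in\mathbb Z$. Let $A_1=A\rtimes T$ be the semidirect product of the trivial braces on $A$ and $T$, that is, $(a,\tau)+(c,\upsilon)=(a+c,\tau\upsilon)$ and $(a,\tau)\circ(c,\upsilon)=(a+\tau(c),\tau\upsilon)$. Let $(A^2,r)$ be the solution with $\sigma_{(a_1,a_2)}(c_1,c_2)=(t(c_1)+a_2,\;t(c_2-j_{t(c_1)+a_2-a_1}))$. Suppose that $A$ has finite exponent $n$. Let $H'$ be the group of finitely supported functions $A\to\mathbb Z/(n)$, and define $\alpha'\colon A_1\to\mathrm{Aut}(H')$ and $b'\colon H'\times H'\to A_1$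 by $$\alpha'(a,t^z)(f)=f\circ g_{(a,t^z)},\qquad g_{(a,t^z)}(x)=t^{-z}\bigl(x-a-(t-\mathrm{id})^{-2}(t^{z+1}-t)(j_0)\bigr),$$ $$b'(f,h)=\Bigl(\sum_{x,y\in A}f(x)h(y)\,t(j_{x-y}-j_0),\ \mathrm{id}\Bigr).$$ Let $B'=H'\rtimes_\circ A_1$ be the asymmetric product via $\alpha'$ and $b'$. Let $e'_a\in H'$ be the indicator function of $\{a\}$, put $x'_{(a,c)}=(e'_a,(c-t(t-\mathrm{id})^{-1}(j_0),t))\in B'$ and $X'=\{x'_{(a,c)}\mid a,c\in A\}$, and let $r'$ be the restriction to $(X')^2$ of the solution $(u,v)\mapsto(\lambda_u(v),\lambda_{\lambda_u(v)}^{-1}(u))$ associated to $B'$. **Theorem 4.5.** Suppose that $n>1$ and that the order of $t$ is finite and coprime to $n$. Let $H_1=\{f\in H'\mid b'(f,h)=(0,\mathrm{id})\text{ for all }h\in H'\}$, a subgroup of $H'$. Then $\overline\alpha(s)(f+H_1)=\alpha'(s)(f)+H_1$ and $\overline b(f+H_1,h+H_1)=b'(f,h)$ are well defined on $H'/H_1$,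 and, as left braces, $$\mathcal G(X',r')\;\cong\; H'/H_1\rtimes_\circ A_1\;\cong\;\mathcal G(A^2,r),$$ where the middle term is the asymmetric product of the trivial brace $H'/H_1$ and the left brace $A_1$ via $\overline\alpha$ and $\overline b$. -/

import Mathlib

open Function

/-- A left brace: a set `B` with an abelian group structure `+` and a group structure `*` (written
`∘` in the literature) such that `a ∘ (b + c) + a = a ∘ b + a ∘ c`. Since Mathlib's `≃+*` means a
bijection preserving `+` and `*`, an isomorphism of left braces `B → C` is an element of `B ≃+* C`.
-/
class LeftBrace (B : Type*) extends AddCommGroup B, Group B where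
  brace_axiom : ∀ a b c : B, a * (b + c) + a = a * b + a * c

namespace LeftBrace

variable {B : Type*} [LeftBrace B]

theorem mul_zero' (a : B) : a * 0 = a := by
  have h := brace_axiom a 0 0
  rw [add_zero] at h
  exact (add_left_cancel h).symm

theorem zero_eq_one : (0 : B) = 1 := by
  have h := mul_zero' (1 : B)
  rwa [one_mul] at h

theorem mul_add' (a b c : B) : a * (b + c) = a * b + a * c - a := by
  rw [← brace_axiom a b c, add_sub_cancel_right]

/-- The lambda map `λ_a(b) = -a + a ∘ b`. -/
def lam (a b : B) : B := -a + a * b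

theorem mul_eq (a b : B) : a * b = a + lam a b := by simp [lam]

theorem lam_add (a b c : B) : lam a (b + c) = lam a b + lam a c := by
  simp only [lam, mul_add']; abel

theorem lam_one (b : B) : lam 1 b = b := by
  rw [lam, one_mul, ← zero_eq_one, neg_zero, zero_add]

theorem lam_zero (a : B) : lam a 0 = 0 := by
  simp [lam, mul_zero']

theorem lam_mul (a b c : B) : lam (a * b) c = lam a (lam b c) := by
  have h : a * b + lam a (lam b c) = a * b * c := by
    have h1 : a * b * c = a * (b + lam b c) := by rw [← mul_eq, mul_assoc]
    rw [h1, mul_add', mul_eq a (lam b c)]; abel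
  rw [lam, ← h]; abel

/-- The permutation `λ_a` of a left brace, with inverse `λ_{a⁻¹}`. -/
def lamPerm (a : B) : Equiv.Perm B where
  toFun := lam a
  invFun := lam a⁻¹
  left_inv b := by rw [← lam_mul, inv_mul_cancel, lam_one]
  right_inv b := by rw [← lam_mul, mul_inv_cancel, lam_one]

end LeftBrace

/-- The map `r × id` on `X³`. -/
def r12 {X : Type*} (r : X × X → X × X) (p : X × X × X) : X × X × X :=
  ((r (p.1, p.2.1)).1, (r (p.1, p.2.1)).2, p.2.2)

/-- The map `id × r` on `X³`. -/
def r23 {X : Type*} (r : X × X → X × X) (p : X × X × X) : X × X × X :=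
  (p.1, r p.2)

/-- An involutive, non-degenerate set-theoretic solution `(X, r)` of the Yang--Baxter equation:
`r² = id`, with `r (x, y) = (σ_x y, γ_y x)` all `σ_x` and all `γ_y` are bijective, and
`r₁₂ r₂₃ r₁₂ = r₂₃ r₁₂ r₂₃`. -/
structure YBSolution (X : Type*) where
  r : X × X → X × X
  invol : ∀ p, r (r p) = p
  left_bij : ∀ x, Bijective fun y => (r (x, y)).1
  right_bij : ∀ y, Bijective fun x => (r (x, y)).2
  braid : ∀ p, r12 r (r23 r (r12 r p)) = r23 r (r12 r (r23 r p))

namespace YBSolution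

section Basic

variable {X : Type*} (S : YBSolution X)

/-- The permutation `σ_x`, where `r (x, y) = (σ_x y, γ_y x)`. -/
noncomputable def sigma (x : X) : Equiv.Perm X := Equiv.ofBijective _ (S.left_bij x)

/-- The permutation `γ_y`, where `r (x, y) = (σ_x y, γ_y x)`. -/
noncomputable def gam (y : X) : Equiv.Perm X := Equiv.ofBijective _ (S.right_bij y)

theorem r_eq (x y : X) : S.r (x, y) = (S.sigma x y, S.gam y x) := rfl

theorem sigma_gam (x y : X) : S.sigma (S.sigma x y) (S.gam y x) = x :=
  congrArg Prod.fst (S.invol (x, y))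

theorem gam_gam (x y : X) : S.gam (S.gam y x) (S.sigma x y) = y :=
  congrArg Prod.snd (S.invol (x, y))

theorem sigma_mul (x y : X) :
    S.sigma x * S.sigma y = S.sigma (S.sigma x y) * S.sigma (S.gam y x) := by
  ext z
  exact (congrArg Prod.fst (S.braid (x, y, z))).symm

theorem gam_eq (x y : X) : S.gam y x = (S.sigma (S.sigma x y))⁻¹ x := by
  rw [Equiv.Perm.eq_inv_iff_eq, sigma_gam]

theorem diag_bij : Bijective fun x => (S.sigma x)⁻¹ x := by
  have key : ∀ x u, (S.sigma x)⁻¹ x = u ↔ S.gam u x = u := by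
    intro x u
    constructor
    · rintro rfl
      rw [gam_eq]; simp
    · intro h
      have h2 := S.gam_gam x u
      rw [h] at h2
      have h3 := (S.gam u).injective (h2.trans h.symm)
      rw [Equiv.Perm.inv_eq_iff_eq, h3]
  constructor
  · intro x y h
    have h1 := (key x _).1 rfl
    have h2 := (key y _).1 h.symm
    exact (S.gam _).injective (h1.trans h2.symm)
  · intro u
    exact ⟨(S.gam u)⁻¹ u, (key _ _).2 (by simp)⟩

/-- The permutation `x ↦ σ_x⁻¹(x)`. -/
noncomputable def diag : Equiv.Perm X := Equiv.ofBijective _ S.diag_bij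

theorem diag_apply (x : X) : S.diag x = (S.sigma x)⁻¹ x := rfl

theorem sigma_diag (x : X) : S.sigma x (S.diag x) = x := by simp [diag_apply]

end Basic

/-- The solution `r (x, y) = (σ_x y, σ_{σ_x y}⁻¹ x)` attached to a family of permutations `σ_x` with
`σ_x σ_{σ_x⁻¹ y} = σ_y σ_{σ_y⁻¹ x}`, when moreover `x ↦ σ_x⁻¹ x` is bijective. -/
def ofSigma {X : Type*} (σ : X → Equiv.Perm X)
    (hσ : ∀ x y z, σ x (σ ((σ x)⁻¹ y) z) = σ y (σ ((σ y)⁻¹ x) z))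
    (hT : Bijective fun x => (σ x)⁻¹ x) : YBSolution X where
  r p := (σ p.1 p.2, (σ (σ p.1 p.2))⁻¹ p.1)
  invol p := by
    obtain ⟨x, y⟩ := p
    simp
  left_bij x := (σ x).bijective
  right_bij y := by
    have h : (fun x => (σ x)⁻¹ x) ∘ (fun x => (σ (σ x y))⁻¹ x) =
        ⇑(σ y)⁻¹ ∘ fun x => (σ x)⁻¹ x := by
      funext x
      simp only [comp_apply]
      rw [Equiv.Perm.eq_inv_iff_eq, ← (σ x).injective.eq_iff]
      have h1 := hσ x (σ x y) ((σ ((σ (σ x y))⁻¹ x))⁻¹ ((σ (σ x y))⁻¹ x))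
      simp only [Equiv.Perm.coe_inv, Equiv.symm_apply_apply, Equiv.apply_symm_apply] at h1 ⊢
      exact h1
    have h2 : Bijective ((fun x => (σ x)⁻¹ x) ∘ (fun x => (σ (σ x y))⁻¹ x)) := by
      rw [h]; exact ((σ y)⁻¹).bijective.comp hT
    exact (Bijective.of_comp_iff' hT _).1 h2
  braid := by
    have hc : ∀ x y z, σ (σ x y) (σ ((σ (σ x y))⁻¹ x) z) = σ x (σ y z) := by
      intro x y z
      have := hσ x (σ x y) z
      simp only [Equiv.Perm.coe_inv, Equiv.symm_apply_apply] at this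
      exact this.symm
    let r : X × X → X × X := fun p => (σ p.1 p.2, (σ (σ p.1 p.2))⁻¹ p.1)
    let J : X × X × X → X × X × X := fun p => (p.1, σ p.1 p.2.1, σ p.1 (σ p.2.1 p.2.2))
    have hJ : Injective J := by
      rintro ⟨x, y, z⟩ ⟨x', y', z'⟩ h
      simp only [J, Prod.mk.injEq] at h
      obtain ⟨rfl, h2, h3⟩ := h
      obtain rfl := (σ x).injective h2
      obtain rfl := (σ y).injective ((σ x).injective h3)
      rfl
    have h12 : ∀ p, J (r12 r p) = ((J p).2.1, (J p).1, (J p).2.2) := by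
      rintro ⟨x, y, z⟩
      have h := hc x y z
      simp only [Equiv.Perm.coe_inv] at h
      simp [J, r12, r, h]
    have h23 : ∀ p, J (r23 r p) = ((J p).1, (J p).2.2, (J p).2.1) := by
      rintro ⟨x, y, z⟩
      simp [J, r23, r]
    intro p
    apply hJ
    change J (r12 r (r23 r (r12 r p))) = J (r23 r (r12 r (r23 r p)))
    simp only [h12, h23]

end YBSolution

/-- The solution associated to a left brace `B`:
`r_B (a, b) = (λ_a b, λ_{λ_a b}⁻¹ a)`. -/
def LeftBrace.solution (B : Type*) [LeftBrace B] : YBSolution B :=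
  YBSolution.ofSigma LeftBrace.lamPerm
    (by
      intro x y z
      change LeftBrace.lam x (LeftBrace.lam (LeftBrace.lam x⁻¹ y) z) =
        LeftBrace.lam y (LeftBrace.lam (LeftBrace.lam y⁻¹ x) z)
      have h : ∀ a b : B, a * LeftBrace.lam a⁻¹ b = a + b := by
        intro a b
        rw [LeftBrace.mul_eq, ← LeftBrace.lam_mul, mul_inv_cancel, LeftBrace.lam_one]
      rw [← LeftBrace.lam_mul, ← LeftBrace.lam_mul, h, h, add_comm])
    (by
      have h : (fun x : B => (LeftBrace.lamPerm x)⁻¹ x) = fun x => -x⁻¹ := by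
        funext x
        change LeftBrace.lam x⁻¹ x = _
        rw [LeftBrace.lam, inv_mul_cancel, ← LeftBrace.zero_eq_one, add_zero]
      rw [h]
      exact (Equiv.neg B).bijective.comp (Equiv.inv B).bijective)

theorem LeftBrace.solution_r {B : Type*} [LeftBrace B] (a b : B) :
    (LeftBrace.solution B).r (a, b) =
      (LeftBrace.lam a b, LeftBrace.lam (LeftBrace.lam a b)⁻¹ a) := rfl


section

universe u v

/-- Auxiliary: a group `G` generated by elements `ι x` (`x ∈ X`), subject at least to the relations
`ι x * ι y = ι (σ_x y) * ι (γ_y x)`, together with an action of `G` on `X` in which `ι x` acts as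
`σ_x`. Both the structure group and the permutation group of `(X, r)` are of this form, and the
natural left brace structure is constructed on both at once. -/
structure YBSolution.Realization {X : Type u} (S : YBSolution X) (G : Type v) [Group G] where
  ι : X → G
  act : G →* Equiv.Perm X
  act_ι : ∀ x, act (ι x) = S.sigma x
  gen : Subgroup.closure (Set.range ι) = ⊤
  rel : ∀ x y, ι x * ι y = ι (S.sigma x y) * ι (S.gam y x)

namespace YBSolution.Realization

variable {X : Type u} {S : YBSolution X} {G : Type v} [Group G] (R : S.Realization G)

/-- The permutation `g ↦ g * ι (g⁻¹ y)` of `G`; it becomes the additive translation by `ι y`. -/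
noncomputable def shift (y : X) : Equiv.Perm G where
  toFun g := g * R.ι ((R.act g)⁻¹ y)
  invFun h := h * (R.ι (S.diag.symm ((R.act h)⁻¹ y)))⁻¹
  left_inv g := by
    have h : (R.act (g * R.ι ((R.act g)⁻¹ y)))⁻¹ y = S.diag ((R.act g)⁻¹ y) := by
      rw [map_mul, R.act_ι, mul_inv_rev, Equiv.Perm.mul_apply, S.diag_apply]
    simp only [h, Equiv.symm_apply_apply, mul_inv_cancel_right]
  right_inv h := by
    have e : (R.act (h * (R.ι (S.diag.symm ((R.act h)⁻¹ y)))⁻¹))⁻¹ y =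
        S.diag.symm ((R.act h)⁻¹ y) := by
      rw [map_mul, map_inv, R.act_ι, mul_inv_rev, inv_inv, Equiv.Perm.mul_apply]
      conv_lhs => rw [← S.diag.apply_symm_apply ((R.act h)⁻¹ y)]
      rw [Equiv.symm_apply_apply, sigma_diag]
    simp only [e, inv_mul_cancel_right]

theorem shift_apply (y : X) (g : G) : R.shift y g = g * R.ι ((R.act g)⁻¹ y) := rfl

theorem shift_comm (y z : X) : R.shift y * R.shift z = R.shift z * R.shift y := by
  ext g
  simp only [Equiv.Perm.mul_apply, shift_apply, map_mul, R.act_ι, mul_inv_rev]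
  set a := (R.act g)⁻¹ y
  set b := (R.act g)⁻¹ z
  have h := R.rel a ((S.sigma a)⁻¹ b)
  rw [S.gam_eq, show S.sigma a ((S.sigma a)⁻¹ b) = b by simp] at h
  rw [mul_assoc, mul_assoc, h]

/-- The group generated by the permutations `g ↦ g * ι (g⁻¹ y)`; it is abelian and regular. -/
def shifts : Subgroup (Equiv.Perm G) := Subgroup.closure (Set.range R.shift)

theorem shifts_comm {σ τ : Equiv.Perm G} (hσ : σ ∈ R.shifts) (hτ : τ ∈ R.shifts) :
    σ * τ = τ * σ := by
  have h := Subgroup.isMulCommutative_closure (k := Set.range R.shift) (by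
    rintro _ ⟨y, rfl⟩ _ ⟨z, rfl⟩
    exact R.shift_comm y z)
  exact congrArg Subtype.val (h.is_comm.comm (⟨σ, hσ⟩ : R.shifts) ⟨τ, hτ⟩)

theorem exists_shift (g : G) : ∃ τ ∈ R.shifts, τ 1 = g := by
  have hg : g ∈ Subgroup.closure (Set.range R.ι) := by rw [R.gen]; trivial
  induction hg using Subgroup.closure_induction_right with
  | one => exact ⟨1, one_mem _, rfl⟩
  | mul_right g _ x hx ih =>
    obtain ⟨x, rfl⟩ := hx
    obtain ⟨τ, hτ, h⟩ := ih
    refine ⟨R.shift (R.act g x) * τ, mul_mem (Subgroup.subset_closure ⟨_, rfl⟩) hτ, ?_⟩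
    rw [Equiv.Perm.mul_apply, h, shift_apply]; simp
  | mul_inv_cancel g _ x hx ih =>
    obtain ⟨x, rfl⟩ := hx
    obtain ⟨τ, hτ, h⟩ := ih
    refine ⟨(R.shift (R.act g (S.diag x)))⁻¹ * τ,
      mul_mem (inv_mem (Subgroup.subset_closure ⟨_, rfl⟩)) hτ, ?_⟩
    rw [Equiv.Perm.mul_apply, h, Equiv.Perm.inv_eq_iff_eq, shift_apply, map_mul, map_inv,
      R.act_ι, mul_inv_rev, inv_inv, Equiv.Perm.mul_apply]
    simp [sigma_diag]

theorem shift_ext {σ τ : Equiv.Perm G} (hσ : σ ∈ R.shifts) (hτ : τ ∈ R.shifts)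
    (h : σ 1 = τ 1) : σ = τ := by
  ext g
  obtain ⟨ρ, hρ, rfl⟩ := R.exists_shift g
  rw [← Equiv.Perm.mul_apply, ← Equiv.Perm.mul_apply, R.shifts_comm hσ hρ,
    R.shifts_comm hτ hρ, Equiv.Perm.mul_apply, Equiv.Perm.mul_apply, h]

/-- The unique element of `shifts` sending `1` to `g`; it becomes the translation `h ↦ g + h`. -/
noncomputable def transl (g : G) : Equiv.Perm G := (R.exists_shift g).choose

theorem transl_mem (g : G) : R.transl g ∈ R.shifts := (R.exists_shift g).choose_spec.1

theorem transl_one (g : G) : R.transl g 1 = g := (R.exists_shift g).choose_spec.2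

theorem eq_transl {τ : Equiv.Perm G} (hτ : τ ∈ R.shifts) : τ = R.transl (τ 1) :=
  R.shift_ext hτ (R.transl_mem _) (R.transl_one _).symm

theorem transl_transl (a b : G) : R.transl (R.transl a b) = R.transl a * R.transl b := by
  rw [R.eq_transl (mul_mem (R.transl_mem a) (R.transl_mem b)), Equiv.Perm.mul_apply,
    R.transl_one]

theorem transl_comm (a b : G) : R.transl a b = R.transl b a := by
  have h := R.shifts_comm (R.transl_mem a) (R.transl_mem b)
  have h1 := congrArg (fun τ : Equiv.Perm G => τ 1) h
  simpa [R.transl_one] using h1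

theorem transl_ι (x : X) : R.transl (R.ι x) = R.shift x := by
  have h : R.shift x ∈ R.shifts := Subgroup.subset_closure ⟨x, rfl⟩
  have h1 := R.eq_transl h
  rw [shift_apply] at h1
  simpa using h1.symm

theorem conj_mem (g : G) {τ : Equiv.Perm G} (hτ : τ ∈ R.shifts) :
    Equiv.mulLeft g * τ * (Equiv.mulLeft g)⁻¹ ∈ R.shifts := by
  induction hτ using Subgroup.closure_induction with
  | mem τ h =>
    obtain ⟨y, rfl⟩ := h
    refine Subgroup.subset_closure ⟨R.act g y, ?_⟩
    ext h
    simp [shift_apply, ← mul_assoc]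
  | one =>
    rw [mul_one, mul_inv_cancel]
    exact one_mem _
  | mul σ τ _ _ h1 h2 =>
    have h := mul_mem h1 h2
    rwa [conj_mul] at h
  | inv σ _ h =>
    have h := inv_mem h
    rwa [conj_inv] at h

theorem mul_transl (g a b : G) :
    R.transl (g * R.transl a b) g = R.transl (g * a) (g * b) := by
  set c := Equiv.mulLeft g * R.transl a * (Equiv.mulLeft g)⁻¹ with hc
  have hm : c ∈ R.shifts := R.conj_mem g (R.transl_mem a)
  have hcg : ∀ h, c (g * h) = g * R.transl a h := by intro h; simp [hc]
  clear_value c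
  have h1 : c * R.transl g = R.transl (g * a) := by
    apply R.shift_ext (mul_mem hm (R.transl_mem g)) (R.transl_mem _)
    have := hcg 1
    simpa [R.transl_one] using this
  rw [← h1, ← hcg]
  have h2 : R.transl (c (g * b)) = c * R.transl (g * b) := by
    rw [R.eq_transl (mul_mem hm (R.transl_mem (g * b))), Equiv.Perm.mul_apply, R.transl_one]
  rw [h2, Equiv.Perm.mul_apply, Equiv.Perm.mul_apply, R.transl_comm]

/-- The natural left brace structure on `G`. Its multiplication is the one of `G`, and its addition is
the one for which `g * ι x = g + ι (g x)` (see `brace_mul_ι`), i.e. `λ_g (ι x) = ι (g x)`. -/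
@[reducible] noncomputable def brace : LeftBrace G :=
  { (inferInstance : Group G) with
    add := fun a b => R.transl a b
    zero := 1
    neg := fun a => (R.transl a)⁻¹ 1
    nsmul := @nsmulRec G ⟨1⟩ ⟨fun a b => R.transl a b⟩
    zsmul := @zsmulRec G ⟨1⟩ ⟨fun a b => R.transl a b⟩ ⟨fun a => (R.transl a)⁻¹ 1⟩
      (@nsmulRec G ⟨1⟩ ⟨fun a b => R.transl a b⟩)
    add_assoc := fun a b c => by
      change R.transl (R.transl a b) c = R.transl a (R.transl b c)
      rw [transl_transl]; rfl
    zero_add := fun a => by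
      change R.transl 1 a = a
      rw [R.transl_comm, R.transl_one]
    add_zero := fun a => R.transl_one a
    neg_add_cancel := fun a => by
      change R.transl ((R.transl a)⁻¹ 1) a = 1
      rw [R.transl_comm]; simp
    add_comm := fun a b => R.transl_comm a b
    brace_axiom := fun a b c => R.mul_transl a b c }

theorem brace_add (a b : G) : R.brace.add a b = R.transl a b := rfl

/-- The lambda map: `g ∘ ι x = g + ι (g x)`. -/
theorem brace_mul_ι (g : G) (x : X) :
    g * R.ι x = (letI := R.brace; g + R.ι (R.act g x)) := by
  change _ = R.transl g (R.ι (R.act g x))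
  rw [R.transl_comm, R.transl_ι, R.shift_apply]
  simp

/-- Homomorphisms compatible with `ι` and with the actions preserve the addition. -/
theorem map_transl {G' : Type*} [Group G'] (R' : S.Realization G') (f : G →* G')
    (hι : ∀ x, f (R.ι x) = R'.ι x) (hact : ∀ g, R'.act (f g) = R.act g) (a b : G) :
    f (R.transl a b) = R'.transl (f a) (f b) := by
  have h : ∀ τ ∈ R.shifts, ∃ τ' ∈ R'.shifts, ∀ g, f (τ g) = τ' (f g) := by
    intro τ hτ
    induction hτ using Subgroup.closure_induction with
    | mem τ h =>
      obtain ⟨y, rfl⟩ := h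
      refine ⟨R'.shift y, Subgroup.subset_closure ⟨y, rfl⟩, fun g => ?_⟩
      rw [shift_apply, shift_apply, map_mul, hι, hact]
    | one => exact ⟨1, one_mem _, fun g => rfl⟩
    | mul σ τ _ _ h1 h2 =>
      obtain ⟨σ', hσ, e1⟩ := h1
      obtain ⟨τ', hτ, e2⟩ := h2
      exact ⟨σ' * τ', mul_mem hσ hτ, fun g => by simp [e1, e2]⟩
    | inv σ _ h =>
      obtain ⟨σ', hσ, e1⟩ := h
      refine ⟨σ'⁻¹, inv_mem hσ, fun g => ?_⟩
      rw [Equiv.Perm.eq_inv_iff_eq, ← e1]; simp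
  obtain ⟨τ', hτ', e⟩ := h _ (R.transl_mem a)
  have h1 : τ' 1 = f a := by rw [← map_one f, ← e, R.transl_one]
  rw [e, R'.eq_transl hτ', h1]

end YBSolution.Realization

end

namespace YBSolution

variable {X : Type*} (S : YBSolution X)

/-- The structure group `G(X, r) = gr(x ∈ X | x y = σ_x(y) γ_y(x) for all x, y ∈ X)`. -/
def StructureGroup : Type _ :=
  PresentedGroup {w : FreeGroup X | ∃ x y, w = FreeGroup.of x * FreeGroup.of y *
    (FreeGroup.of (S.sigma x y) * FreeGroup.of (S.gam y x))⁻¹}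

instance : Group S.StructureGroup := inferInstanceAs (Group (PresentedGroup _))

/-- The permutation group `gr(σ_x | x ∈ X)` of `(X, r)`, a subgroup of `Sym_X`. Its natural left brace
structure, installed as an instance below, is the unique one for which the canonical map `φ` from the
structure group is a homomorphism of left braces (`toPermutationGroup_add`,
`toPermutationGroup_surjective`). -/
def PermutationGroup : Type _ := Subgroup.closure (Set.range S.sigma)

instance : Group S.PermutationGroup :=
  inferInstanceAs (Group (Subgroup.closure (Set.range S.sigma)))

/-- The generator `x` of the structure group. -/
def StructureGroup.of (x : X) : S.StructureGroup := PresentedGroup.of x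

/-- The element `σ_x` of the permutation group. -/
noncomputable def PermutationGroup.of (x : X) : S.PermutationGroup :=
  ⟨S.sigma x, Subgroup.subset_closure ⟨x, rfl⟩⟩

/-- The canonical group homomorphism `φ` from the structure group to the permutation group, `x ↦ σ_x`. -/
noncomputable def toPermutationGroup : S.StructureGroup →* S.PermutationGroup :=
  PresentedGroup.toGroup (f := PermutationGroup.of S) (by
    rintro _ ⟨x, y, rfl⟩
    simp only [map_mul, map_inv, FreeGroup.lift_apply_of]
    rw [mul_inv_eq_one]
    exact Subtype.ext (S.sigma_mul x y))

theorem toPermutationGroup_of (x : X) :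
    S.toPermutationGroup (StructureGroup.of S x) = PermutationGroup.of S x :=
  PresentedGroup.toGroup.of _

/-- The inclusion of the permutation group in `Sym_X`. -/
def PermutationGroup.toPerm : S.PermutationGroup →* Equiv.Perm X :=
  (Subgroup.closure (Set.range S.sigma)).subtype

/-- The permutation group, generated by the `σ_x`. -/
noncomputable def permRealization : S.Realization S.PermutationGroup where
  ι := PermutationGroup.of S
  act := PermutationGroup.toPerm S
  act_ι _ := rfl
  gen := by
    have h := Subgroup.closure_closure_coe_preimage (k := Set.range S.sigma)
    have e : Set.range (PermutationGroup.of S) =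
        ((↑) : Subgroup.closure (Set.range S.sigma) → Equiv.Perm X) ⁻¹' Set.range S.sigma := by
      ext g
      constructor
      · rintro ⟨x, rfl⟩
        exact ⟨x, rfl⟩
      · rintro ⟨x, hx⟩
        exact ⟨x, Subtype.ext hx⟩
    rw [e]
    exact h
  rel x y := Subtype.ext (S.sigma_mul x y)

/-- The structure group, generated by `X`, acting on `X` through `φ`. -/
noncomputable def structureRealization : S.Realization S.StructureGroup where
  ι := StructureGroup.of S
  act := (PermutationGroup.toPerm S).comp S.toPermutationGroup
  act_ι x := by rw [MonoidHom.comp_apply, toPermutationGroup_of]; rfl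
  gen := PresentedGroup.closure_range_of _
  rel x y := by
    have h : PresentedGroup.mk {w : FreeGroup X | ∃ x y, w = FreeGroup.of x * FreeGroup.of y *
        (FreeGroup.of (S.sigma x y) * FreeGroup.of (S.gam y x))⁻¹}
        (FreeGroup.of x * FreeGroup.of y *
        (FreeGroup.of (S.sigma x y) * FreeGroup.of (S.gam y x))⁻¹) = 1 :=
      PresentedGroup.one_of_mem ⟨x, y, rfl⟩
    rw [map_mul, map_inv, mul_inv_eq_one, map_mul, map_mul] at h
    exact h

/-- The natural left brace structure of the structure group, with `λ_x y = σ_x y` on generators. -/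
noncomputable instance : LeftBrace S.StructureGroup := S.structureRealization.brace

/-- The natural left brace structure of the permutation group. -/
noncomputable instance : LeftBrace S.PermutationGroup := S.permRealization.brace

theorem StructureGroup.lam_of (x y : X) :
    LeftBrace.lam (StructureGroup.of S x) (StructureGroup.of S y) =
      StructureGroup.of S (S.sigma x y) := by
  have h := S.structureRealization.brace_mul_ι (StructureGroup.of S x) y
  have h1 : S.structureRealization.act (StructureGroup.of S x) = S.sigma x :=
    S.structureRealization.act_ι x
  rw [h1] at h
  exact neg_add_eq_iff_eq_add.2 h

/-- `φ` is a homomorphism of left braces. -/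
theorem toPermutationGroup_add (a b : S.StructureGroup) :
    S.toPermutationGroup (a + b) = S.toPermutationGroup a + S.toPermutationGroup b :=
  S.structureRealization.map_transl S.permRealization S.toPermutationGroup
    S.toPermutationGroup_of (fun _ => rfl) a b

theorem toPermutationGroup_surjective : Surjective S.toPermutationGroup := by
  rw [← MonoidHom.range_eq_top, eq_top_iff, ← S.permRealization.gen, Subgroup.closure_le]
  rintro _ ⟨x, rfl⟩
  exact ⟨_, S.toPermutationGroup_of x⟩

end YBSolution

/-- The restriction of a solution to a subset `Y` that all `σ_x` and `γ_y` with `x, y ∈ Y` map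
bijectively onto itself. -/
def YBSolution.restrict {X : Type*} (S : YBSolution X) (Y : Set X)
    (hl : ∀ x ∈ Y, Set.BijOn (S.sigma x) Y Y) (hr : ∀ y ∈ Y, Set.BijOn (S.gam y) Y Y) :
    YBSolution Y where
  r p := (⟨(S.r (p.1, p.2)).1, (hl _ p.1.2).mapsTo p.2.2⟩,
    ⟨(S.r (p.1, p.2)).2, (hr _ p.2.2).mapsTo p.1.2⟩)
  invol p := by
    have h := S.invol (p.1, p.2)
    ext
    · exact congrArg Prod.fst h
    · exact congrArg Prod.snd h
  left_bij x := (hl _ x.2).bijective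
  right_bij y := (hr _ y.2).bijective
  braid p := by
    have h := S.braid (p.1, p.2.1, p.2.2)
    ext
    · exact congrArg (fun q => q.1) h
    · exact congrArg (fun q => q.2.1) h
    · exact congrArg (fun q => q.2.2) h

/-- The semidirect product `A ⋊ T` of the trivial left braces on an abelian group `A` (written
additively) and an abelian group `T` (written multiplicatively), where `T` acts on `A` by
automorphisms through `φ`. Group automorphisms of `A` are the same as `ℤ`-linear ones; they form the
group `A ≃ₗ[ℤ] A` under composition. The operations are
`(a, τ) + (c, υ) = (a + c, τ υ)` and `(a, τ) ∘ (c, υ) = (a + φ_τ(c), τ υ)`. -/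
@[ext] structure SemidirectBrace {A T : Type*} [AddCommGroup A] [CommGroup T]
    (φ : T →* (A ≃ₗ[ℤ] A)) where
  fst : A
  snd : T

namespace SemidirectBrace

variable {A T : Type*} [AddCommGroup A] [CommGroup T] {φ : T →* (A ≃ₗ[ℤ] A)}

instance : Add (SemidirectBrace φ) := ⟨fun p q => ⟨p.fst + q.fst, p.snd * q.snd⟩⟩
instance : Zero (SemidirectBrace φ) := ⟨⟨0, 1⟩⟩
instance : Neg (SemidirectBrace φ) := ⟨fun p => ⟨-p.fst, p.snd⁻¹⟩⟩
instance : Mul (SemidirectBrace φ) := ⟨fun p q => ⟨p.fst + φ p.snd q.fst, p.snd * q.snd⟩⟩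
instance : One (SemidirectBrace φ) := ⟨⟨0, 1⟩⟩
instance : Inv (SemidirectBrace φ) := ⟨fun p => ⟨-(φ p.snd⁻¹ p.fst), p.snd⁻¹⟩⟩

@[simp] theorem add_fst (p q : SemidirectBrace φ) : (p + q).fst = p.fst + q.fst := rfl
@[simp] theorem add_snd (p q : SemidirectBrace φ) : (p + q).snd = p.snd * q.snd := rfl
@[simp] theorem zero_fst : (0 : SemidirectBrace φ).fst = 0 := rfl
@[simp] theorem zero_snd : (0 : SemidirectBrace φ).snd = 1 := rfl
@[simp] theorem neg_fst (p : SemidirectBrace φ) : (-p).fst = -p.fst := rfl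
@[simp] theorem neg_snd (p : SemidirectBrace φ) : (-p).snd = p.snd⁻¹ := rfl
@[simp] theorem mul_fst (p q : SemidirectBrace φ) : (p * q).fst = p.fst + φ p.snd q.fst := rfl
@[simp] theorem mul_snd (p q : SemidirectBrace φ) : (p * q).snd = p.snd * q.snd := rfl
@[simp] theorem one_fst : (1 : SemidirectBrace φ).fst = 0 := rfl
@[simp] theorem one_snd : (1 : SemidirectBrace φ).snd = 1 := rfl
@[simp] theorem inv_fst (p : SemidirectBrace φ) : p⁻¹.fst = -(φ p.snd⁻¹ p.fst) := rfl
@[simp] theorem inv_snd (p : SemidirectBrace φ) : p⁻¹.snd = p.snd⁻¹ := rfl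

instance : LeftBrace (SemidirectBrace φ) where
  add_assoc p q s := by ext <;> simp [add_assoc, mul_assoc]
  zero_add p := by ext <;> simp
  add_zero p := by ext <;> simp
  neg_add_cancel p := by ext <;> simp
  add_comm p q := by ext <;> simp [add_comm, mul_comm]
  nsmul := nsmulRec
  zsmul := zsmulRec
  mul_assoc p q s := by ext <;> simp [add_assoc, mul_assoc]
  one_mul p := by ext <;> simp
  mul_one p := by ext <;> simp
  inv_mul_cancel p := by ext <;> simp
  brace_axiom p q s := by
    ext
    · simp only [add_fst, mul_fst, map_add]; abel
    · simp only [add_snd, mul_snd]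
      rw [mul_assoc, mul_assoc, mul_assoc, mul_comm s.snd p.snd]

theorem lam_eq (p q : SemidirectBrace φ) : LeftBrace.lam p q = ⟨φ p.snd q.fst, q.snd⟩ := by
  ext <;> simp [LeftBrace.lam]

end SemidirectBrace

/-- The data of an asymmetric product of the trivial left brace on an abelian group `H` by a left brace
`S`: a homomorphism `α` from the multiplicative group of `S` to `Aut(H, +)` and a symmetric bilinear
map `b : H × H → (S, +)` with `λ_s (b f h) = b (α_s f) (α_s h)`. -/
structure AsymmetricDatum (H S : Type*) [AddCommGroup H] [LeftBrace S] where
  α : S →* (H ≃ₗ[ℤ] H)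
  b : H →+ H →+ S
  symm : ∀ f h, b f h = b h f
  equivariant : ∀ s f h, LeftBrace.lam s (b f h) = b (α s f) (α s h)

/-- The asymmetric product `H ⋊_∘ S` via `α` and `b`: the left brace on the set `H × S` with
`(f, s) ∘ (h, u) = (f + α_s h, s ∘ u)` and `(f, s) + (h, u) = (f + h, s + u + b f h)`. -/
@[ext] structure AsymmetricProduct {H S : Type*} [AddCommGroup H] [LeftBrace S]
    (D : AsymmetricDatum H S) where
  fst : H
  snd : S

namespace AsymmetricProduct

variable {H S : Type*} [AddCommGroup H] [LeftBrace S] {D : AsymmetricDatum H S}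

instance : Add (AsymmetricProduct D) :=
  ⟨fun p q => ⟨p.fst + q.fst, p.snd + q.snd + D.b p.fst q.fst⟩⟩
instance : Zero (AsymmetricProduct D) := ⟨⟨0, 0⟩⟩
instance : Neg (AsymmetricProduct D) :=
  ⟨fun p => ⟨-p.fst, -p.snd + D.b p.fst p.fst⟩⟩
instance : Mul (AsymmetricProduct D) :=
  ⟨fun p q => ⟨p.fst + D.α p.snd q.fst, p.snd * q.snd⟩⟩
instance : One (AsymmetricProduct D) := ⟨⟨0, 1⟩⟩
instance : Inv (AsymmetricProduct D) :=
  ⟨fun p => ⟨-(D.α p.snd⁻¹ p.fst), p.snd⁻¹⟩⟩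

@[simp] theorem add_fst (p q : AsymmetricProduct D) : (p + q).fst = p.fst + q.fst := rfl
@[simp] theorem add_snd (p q : AsymmetricProduct D) :
    (p + q).snd = p.snd + q.snd + D.b p.fst q.fst := rfl
@[simp] theorem zero_fst : (0 : AsymmetricProduct D).fst = 0 := rfl
@[simp] theorem zero_snd : (0 : AsymmetricProduct D).snd = 0 := rfl
@[simp] theorem neg_fst (p : AsymmetricProduct D) : (-p).fst = -p.fst := rfl
@[simp] theorem neg_snd (p : AsymmetricProduct D) :
    (-p).snd = -p.snd + D.b p.fst p.fst := rfl
@[simp] theorem mul_fst (p q : AsymmetricProduct D) :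
    (p * q).fst = p.fst + D.α p.snd q.fst := rfl
@[simp] theorem mul_snd (p q : AsymmetricProduct D) : (p * q).snd = p.snd * q.snd := rfl
@[simp] theorem one_fst : (1 : AsymmetricProduct D).fst = 0 := rfl
@[simp] theorem one_snd : (1 : AsymmetricProduct D).snd = 1 := rfl
@[simp] theorem inv_fst (p : AsymmetricProduct D) : p⁻¹.fst = -(D.α p.snd⁻¹ p.fst) := rfl
@[simp] theorem inv_snd (p : AsymmetricProduct D) : p⁻¹.snd = p.snd⁻¹ := rfl

instance : LeftBrace (AsymmetricProduct D) where
  add_assoc p q s := by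
    ext
    · simp [add_assoc]
    · simp only [add_snd, add_fst, map_add, AddMonoidHom.add_apply]; abel
  zero_add p := by ext <;> simp
  add_zero p := by ext <;> simp
  neg_add_cancel p := by
    ext
    · simp
    · simp only [add_snd, neg_snd, neg_fst, map_neg, AddMonoidHom.neg_apply, zero_snd]; abel
  add_comm p q := by
    ext
    · simp [add_comm]
    · simp only [add_snd]
      rw [D.symm, add_comm p.snd]
  nsmul := nsmulRec
  zsmul := zsmulRec
  mul_assoc p q s := by ext <;> simp [add_assoc, mul_assoc]
  one_mul p := by ext <;> simp
  mul_one p := by ext <;> simp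
  inv_mul_cancel p := by ext <;> simp
  brace_axiom p q s := by
    ext
    · simp only [add_fst, mul_fst, map_add]; abel
    · simp only [add_fst, add_snd, mul_fst, mul_snd, map_add, AddMonoidHom.add_apply]
      rw [← D.equivariant, D.symm p.fst (D.α p.snd s.fst), LeftBrace.mul_add',
        LeftBrace.mul_add', LeftBrace.mul_eq p.snd (D.b _ _)]
      abel

theorem lam_eq (p q : AsymmetricProduct D) :
    LeftBrace.lam p q = ⟨D.α p.snd q.fst,
      LeftBrace.lam p.snd q.snd - D.b p.fst (D.α p.snd q.fst)⟩ := by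
  rw [LeftBrace.lam, neg_add_eq_iff_eq_add]
  ext
  · simp
  · simp only [mul_snd, add_snd, LeftBrace.mul_eq p.snd]; abel

end AsymmetricProduct

namespace AsymmetricDatum

variable {H S : Type*} [AddCommGroup H] [LeftBrace S] (D : AsymmetricDatum H S)

/-- The radical `H₁ = {f | b f h = 0 for all h}` of the bilinear map `b`. -/
def radical : AddSubgroup H where
  carrier := {f | ∀ h, D.b f h = 0}
  zero_mem' := by simp
  add_mem' := by
    intro f g hf hg h
    rw [map_add, AddMonoidHom.add_apply, hf h, hg h, add_zero]
  neg_mem' := by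
    intro f hf h
    rw [map_neg, AddMonoidHom.neg_apply, hf h, neg_zero]

theorem mem_radical {f : H} : f ∈ D.radical ↔ ∀ h, D.b f h = 0 := Iff.rfl

theorem α_mem_radical (s : S) {f : H} (hf : f ∈ D.radical) : D.α s f ∈ D.radical := by
  intro h
  have h1 := D.equivariant s f (D.α s⁻¹ h)
  rw [hf, LeftBrace.lam_zero, ← LinearEquiv.mul_apply, ← map_mul, mul_inv_cancel, map_one] at h1
  exact h1.symm

/-- The endomorphism of `H ⧸ H₁` induced by `α_s`. -/
def αBarHom (s : S) : H ⧸ D.radical →+ H ⧸ D.radical :=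
  QuotientAddGroup.map D.radical D.radical (D.α s : H →+ H) fun _ hf => D.α_mem_radical s hf

/-- The homomorphism `S → Aut(H ⧸ H₁)` induced by `α`: `s ↦ (f + H₁ ↦ α_s f + H₁)`. -/
def αBar : S →* ((H ⧸ D.radical) ≃ₗ[ℤ] (H ⧸ D.radical)) where
  toFun s := AddEquiv.toIntLinearEquiv
    { D.αBarHom s with
      invFun := D.αBarHom s⁻¹
      left_inv := by
        intro x
        induction x using QuotientAddGroup.induction_on with
        | H f =>
          change ((D.α s⁻¹ (D.α s f) : H) : H ⧸ D.radical) = f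
          rw [← LinearEquiv.mul_apply, ← map_mul, inv_mul_cancel, map_one]; rfl
      right_inv := by
        intro x
        induction x using QuotientAddGroup.induction_on with
        | H f =>
          change ((D.α s (D.α s⁻¹ f) : H) : H ⧸ D.radical) = f
          rw [← LinearEquiv.mul_apply, ← map_mul, mul_inv_cancel, map_one]; rfl }
  map_one' := by
    ext x
    induction x using QuotientAddGroup.induction_on with
    | H f =>
      change ((D.α 1 f : H) : H ⧸ D.radical) = f
      rw [map_one]; rfl
  map_mul' s u := by
    ext x
    induction x using QuotientAddGroup.induction_on with
    | H f =>
      change ((D.α (s * u) f : H) : H ⧸ D.radical) = (D.α s (D.α u f) : H)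
      rw [map_mul]; rfl

/-- The bilinear map induced by `b` on `H ⧸ H₁`. -/
def bBar : H ⧸ D.radical →+ H ⧸ D.radical →+ S :=
  QuotientAddGroup.lift D.radical
    { toFun := fun f => QuotientAddGroup.lift D.radical (D.b f) fun h hh => by
        rw [AddMonoidHom.mem_ker, D.symm]; exact hh f
      map_zero' := by
        ext h
        change D.b 0 h = 0
        simp
      map_add' := fun f g => by
        ext h
        change D.b (f + g) h = D.b f h + D.b g h
        simp }
    fun f hf => by
      rw [AddMonoidHom.mem_ker]
      ext h
      exact hf h

/-- The induced data `(ᾱ, b̄)` on `H ⧸ H₁`. -/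
def modRadical : AsymmetricDatum (H ⧸ D.radical) S where
  α := D.αBar
  b := D.bBar
  symm x y := by
    induction x using QuotientAddGroup.induction_on with
    | H f =>
      induction y using QuotientAddGroup.induction_on with
      | H h => exact D.symm f h
  equivariant s x y := by
    induction x using QuotientAddGroup.induction_on with
    | H f =>
      induction y using QuotientAddGroup.induction_on with
      | H h => exact D.equivariant s f h

theorem modRadical_α (s : S) (f : H) :
    D.modRadical.α s (f : H ⧸ D.radical) = (D.α s f : H) := rfl

theorem modRadical_b (f h : H) :
    D.modRadical.b (f : H ⧸ D.radical) (h : H ⧸ D.radical) = D.b f h := rfl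

end AsymmetricDatum

/-- The standing data on an abelian group `A`: an automorphism `t` of `A` with `t - id` invertible, and
a family `j` of elements of `A` with `j_{-a} = j_a` and
`j_{t^z(a)} = t^z(j_a) - (t^z - id)(j_0)` for all `z ∈ ℤ`. -/
structure SolutionData (A : Type*) [AddCommGroup A] where
  t : A ≃ₗ[ℤ] A
  sub_id_bij : Bijective fun a => t a - a
  j : A → A
  j_neg : ∀ a, j (-a) = j a
  j_zpow : ∀ (z : ℤ) (a : A), j ((t ^ z) a) = (t ^ z) (j a) - ((t ^ z) (j 0) - j 0)

namespace SolutionData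

variable {A : Type*} [AddCommGroup A] (D : SolutionData A)

section Square

/-- The permutation `σ_{(a₁,a₂)}(c₁, c₂) = (t(c₁) + a₂, t(c₂ - j_{t(c₁)+a₂-a₁}))` of `A²`. -/
def squareSigma (a : A × A) : Equiv.Perm (A × A) where
  toFun c := (D.t c.1 + a.2, D.t (c.2 - D.j (D.t c.1 + a.2 - a.1)))
  invFun c := (D.t.symm (c.1 - a.2), D.t.symm c.2 + D.j (c.1 - a.1))
  left_inv c := by simp
  right_inv c := by simp

theorem squareSigma_inv (a c : A × A) : (D.squareSigma a)⁻¹ c =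
    (D.t.symm (c.1 - a.2), D.t.symm c.2 + D.j (c.1 - a.1)) := rfl

theorem j_t (a : A) : D.j (D.t a) = D.t (D.j a) - (D.t (D.j 0) - D.j 0) := by
  simpa using D.j_zpow 1 a

theorem t_j (a : A) : D.t (D.j a) = D.j (D.t a) + (D.t (D.j 0) - D.j 0) := by
  rw [D.j_t, sub_add_cancel]

/-- The solution `(A², r)` with `r (a, c) = (σ_a c, σ_{σ_a c}⁻¹ a)`. -/
def square : YBSolution (A × A) :=
  YBSolution.ofSigma D.squareSigma
    (by
      rintro ⟨a₁, a₂⟩ ⟨c₁, c₂⟩ ⟨x, y⟩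
      rw [squareSigma_inv, squareSigma_inv]
      have e : D.j (a₁ - c₁) = D.j (c₁ - a₁) := by rw [← D.j_neg, neg_sub]
      simp only [squareSigma, Equiv.coe_fn_mk, e]
      ext
      · simp only [map_add, LinearEquiv.apply_symm_apply]; abel
      · generalize D.j (c₁ - a₁) = w
        have h1 := D.t_j (D.t x + (D.t.symm c₂ + w) - D.t.symm (c₁ - a₂))
        have h2 := D.t_j (D.t x + (D.t.symm a₂ + w) - D.t.symm (a₁ - c₂))
        have e1 : D.t (D.t x + (D.t.symm c₂ + w) - D.t.symm (c₁ - a₂)) =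
            D.t (D.t x + (D.t.symm a₂ + w)) + c₂ - c₁ := by
          simp only [map_add, map_sub, LinearEquiv.apply_symm_apply]; abel
        have e2 : D.t (D.t x + (D.t.symm a₂ + w) - D.t.symm (a₁ - c₂)) =
            D.t (D.t x + (D.t.symm c₂ + w)) + a₂ - a₁ := by
          simp only [map_add, map_sub, LinearEquiv.apply_symm_apply]; abel
        rw [e1] at h1
        rw [e2] at h2
        change D.t (D.t (y - _) - _) = D.t (D.t (y - _) - _)
        rw [map_sub D.t y, map_sub D.t y, h1, h2]
        congr 1
        abel)
    (by
      have h : (fun a : A × A => (D.squareSigma a)⁻¹ a) =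
          fun a => (D.t.symm (a.1 - a.2), D.t.symm a.2 + D.j 0) := by
        funext a
        rw [squareSigma_inv, sub_self]
      rw [h, Function.bijective_iff_has_inverse]
      refine ⟨fun a => (D.t (a.1 + a.2 - D.j 0), D.t (a.2 - D.j 0)), fun a => ?_, fun a => ?_⟩
      · ext
        · simp only [map_add, map_sub, LinearEquiv.apply_symm_apply]; abel
        · simp
      · ext
        · simp
        · simp)

end Square

/-- The subgroup `T = ⟨t⟩` of `Aut(A)`. -/
def T : Subgroup (A ≃ₗ[ℤ] A) := Subgroup.zpowers D.t

instance : CommGroup D.T :=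
  { (inferInstance : Group D.T) with
    mul_comm := (Subgroup.zpowers_isMulCommutative D.t).is_comm.comm }

theorem T_comm (τ : D.T) (x : A) : (τ : A ≃ₗ[ℤ] A) (D.t x) = D.t ((τ : A ≃ₗ[ℤ] A) x) := by
  have h := congrArg Subtype.val (mul_comm τ (⟨D.t, Subgroup.mem_zpowers _⟩ : D.T))
  exact congrArg (fun e : A ≃ₗ[ℤ] A => e x) h

theorem j_T (τ : D.T) (a : A) : D.j ((τ : A ≃ₗ[ℤ] A) a) =
    (τ : A ≃ₗ[ℤ] A) (D.j a) - ((τ : A ≃ₗ[ℤ] A) (D.j 0) - D.j 0) := by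
  obtain ⟨_, z, rfl⟩ := τ
  exact D.j_zpow z a

/-- The left brace `A₁ = A ⋊ T`, the semidirect product of the trivial left braces on `A` and `T`. -/
abbrev A₁ : Type _ := SemidirectBrace D.T.subtype

/-- The automorphism `t - id` of `A`. -/
noncomputable def tSubId : A ≃ₗ[ℤ] A :=
  LinearEquiv.ofBijective ((D.t : A →ₗ[ℤ] A) - LinearMap.id) D.sub_id_bij

theorem tSubId_apply (x : A) : D.tSubId x = D.t x - x := rfl

theorem T_comm_tSubId_symm (τ : D.T) (x : A) :
    (τ : A ≃ₗ[ℤ] A) (D.tSubId.symm x) = D.tSubId.symm ((τ : A ≃ₗ[ℤ] A) x) := by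
  rw [LinearEquiv.eq_symm_apply, tSubId_apply, ← D.T_comm, ← map_sub, ← tSubId_apply,
    LinearEquiv.apply_symm_apply]

/-- For `τ = t^z`, the element `(t - id)⁻²(t^{z+1} - t)(j_0)` of `A`. -/
noncomputable def offset (τ : D.T) : A :=
  D.tSubId.symm (D.tSubId.symm (D.t ((τ : A ≃ₗ[ℤ] A) (D.j 0)) - D.t (D.j 0)))

theorem offset_mul (τ υ : D.T) :
    D.offset (τ * υ) = D.offset τ + (τ : A ≃ₗ[ℤ] A) (D.offset υ) := by
  simp only [offset, D.T_comm_tSubId_symm, ← map_add]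
  congr 2
  simp [D.T_comm]

theorem offset_one : D.offset 1 = 0 := by simp [offset]

/-- The bijection `g_{(a,t^z)}(x) = t^{-z}(x - a - (t - id)⁻²(t^{z+1} - t)(j_0))` of `A`. -/
noncomputable def g (p : D.A₁) : Equiv.Perm A where
  toFun x := (p.snd : A ≃ₗ[ℤ] A).symm (x - p.fst - D.offset p.snd)
  invFun x := (p.snd : A ≃ₗ[ℤ] A) x + p.fst + D.offset p.snd
  left_inv x := by
    dsimp only
    rw [LinearEquiv.apply_symm_apply]
    abel
  right_inv x := by
    dsimp only
    rw [LinearEquiv.symm_apply_eq]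
    abel

theorem g_symm_apply (p : D.A₁) (x : A) :
    (D.g p).symm x = (p.snd : A ≃ₗ[ℤ] A) x + p.fst + D.offset p.snd := rfl

theorem g_symm_one : (D.g 1).symm = Equiv.refl A := by
  ext x; simp [g_symm_apply, offset_one]

theorem g_symm_mul (p q : D.A₁) : (D.g (p * q)).symm = (D.g q).symm.trans (D.g p).symm := by
  ext x
  simp only [g_symm_apply, Equiv.trans_apply, SemidirectBrace.mul_fst, SemidirectBrace.mul_snd,
    offset_mul, map_add, Subgroup.coe_mul, LinearEquiv.mul_apply, Subgroup.subtype_apply]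
  abel

variable (A) in
/-- The group of finitely supported functions `A → ℤ/(n)`, where `n` is the exponent of `A`. -/
abbrev H' : Type _ := A →₀ ZMod (AddMonoid.exponent A)

variable (A) in
/-- The `ℤ/(n)`-module structure of `A`, where `n` is the exponent of `A`. -/
@[reducible] noncomputable def exponentModule : Module (ZMod (AddMonoid.exponent A)) A :=
  AddCommGroup.zmodModule AddMonoid.exponent_nsmul_eq_zero

attribute [local instance] exponentModule

/-- The homomorphism from `(A₁, ∘)` to the automorphisms of `H' A`, `(a, t^z) ↦ (f ↦ f ∘ g_{(a,t^z)})`. -/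
noncomputable def α' : D.A₁ →* (H' A ≃ₗ[ℤ] H' A) where
  toFun p := AddEquiv.toIntLinearEquiv (Finsupp.domCongr (D.g p).symm)
  map_one' := by
    ext1 f
    change Finsupp.equivMapDomain (D.g 1).symm f = f
    rw [g_symm_one, Finsupp.equivMapDomain_refl]
  map_mul' p q := by
    ext1 f
    change Finsupp.equivMapDomain (D.g (p * q)).symm f =
      Finsupp.equivMapDomain (D.g p).symm (Finsupp.equivMapDomain (D.g q).symm f)
    rw [g_symm_mul, Finsupp.equivMapDomain_trans]

theorem α'_eq (p : D.A₁) (f : H' A) :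
    D.α' p f = Finsupp.equivMapDomain (D.g p).symm f := rfl

theorem α'_apply (p : D.A₁) (f : H' A) (x : A) : D.α' p f x = f (D.g p x) := rfl

/-- The sum `∑_{x,y ∈ A} f(x) h(y) t(j_{x-y} - j_0)`. -/
noncomputable def form (f h : H' A) : A :=
  f.sum fun x m => h.sum fun y k => (m * k) • D.t (D.j (x - y) - D.j 0)

theorem form_add_left (f₁ f₂ h : H' A) : D.form (f₁ + f₂) h = D.form f₁ h + D.form f₂ h := by
  apply Finsupp.sum_add_index'
  · intro x; simp
  · intro x m₁ m₂; simp [add_mul, add_smul]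

theorem form_comm (f h : H' A) : D.form f h = D.form h f := by
  rw [form, form, Finsupp.sum_comm]
  refine Finsupp.sum_congr fun y _ => Finsupp.sum_congr fun x _ => ?_
  rw [mul_comm, ← D.j_neg (x - y), neg_sub]

theorem form_α' (p : D.A₁) (f h : H' A) :
    D.form (D.α' p f) (D.α' p h) = (p.snd : A ≃ₗ[ℤ] A) (D.form f h) := by
  simp only [form, α'_eq, Finsupp.sum_equivMapDomain, map_finsuppSum]
  refine Finsupp.sum_congr fun x _ => Finsupp.sum_congr fun y _ => ?_
  rw [ZMod.map_smul, D.T_comm, g_symm_apply, g_symm_apply, add_sub_add_right_eq_sub,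
    add_sub_add_right_eq_sub, ← map_sub, D.j_T, map_sub _ (D.j (x - y))]
  congr 2
  abel

/-- The bilinear form `(f, h) ↦ (∑_{x,y ∈ A} f(x) h(y) t(j_{x-y} - j_0), id)` with values in `A₁`. -/
noncomputable def b' : H' A →+ H' A →+ D.A₁ :=
  AddMonoidHom.mk' (fun f => AddMonoidHom.mk' (fun h => ⟨D.form f h, 1⟩) (by
      intro h₁ h₂
      ext
      · change D.form f (h₁ + h₂) = D.form f h₁ + D.form f h₂
        rw [D.form_comm, form_add_left, D.form_comm h₁, D.form_comm h₂]
      · simp)) (by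
    intro f₁ f₂
    refine AddMonoidHom.ext fun h => SemidirectBrace.ext ?_ ?_
    · exact D.form_add_left f₁ f₂ h
    · simp)

theorem b'_apply (f h : H' A) :
    D.b' f h = ⟨∑ x ∈ f.support, ∑ y ∈ h.support, (f x * h y) • D.t (D.j (x - y) - D.j 0), 1⟩ :=
  rfl

/-- The data of the asymmetric product `B'` of `H' A` by `A₁`. -/
noncomputable def datum : AsymmetricDatum (H' A) D.A₁ where
  α := D.α'
  b := D.b'
  symm f h := SemidirectBrace.ext (D.form_comm f h) rfl
  equivariant p f h := by
    rw [SemidirectBrace.lam_eq]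
    exact SemidirectBrace.ext (D.form_α' p f h).symm rfl

/-- The asymmetric product of the trivial left brace `H' A` by `A₁`. -/
abbrev B' : Type _ := AsymmetricProduct D.datum

/-- The element `(e_{a₁}, (a₂ - t(t - id)⁻¹(j_0), t))` attached to `(a₁, a₂)`. -/
noncomputable def x' (a : A × A) : D.B' :=
  ⟨Finsupp.single a.1 1, ⟨a.2 - D.t (D.tSubId.symm (D.j 0)), ⟨D.t, Subgroup.mem_zpowers D.t⟩⟩⟩

/-- The set of all elements `x' (a₁, a₂)`. -/
def X' : Set D.B' := Set.range D.x'

theorem lam_x' (a c : A × A) : LeftBrace.lam (D.x' a) (D.x' c) = D.x' (D.squareSigma a c) := by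
  have ho : D.offset ⟨D.t, Subgroup.mem_zpowers D.t⟩ = D.t (D.tSubId.symm (D.j 0)) := by
    have h := D.T_comm_tSubId_symm ⟨D.t, Subgroup.mem_zpowers D.t⟩ (D.j 0)
    change D.t _ = D.tSubId.symm (D.t _) at h
    rw [offset, h]
    congr 1
    rw [LinearEquiv.symm_apply_eq, tSubId_apply]
  have hα : D.α' (D.x' a).snd (D.x' c).fst = Finsupp.single (D.t c.1 + a.2) 1 := by
    rw [α'_eq]
    simp only [x']
    rw [Finsupp.equivMapDomain_single, g_symm_apply, ho]
    congr 1
    change D.t c.1 + (a.2 - _) + _ = _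
    abel
  rw [AsymmetricProduct.lam_eq]
  change AsymmetricProduct.mk (D.α' _ _) (_ - D.b' _ (D.α' _ _)) = _
  rw [hα, SemidirectBrace.lam_eq]
  refine AsymmetricProduct.ext rfl (SemidirectBrace.ext ?_ ?_)
  · have hf : D.form (Finsupp.single a.1 1) (Finsupp.single (D.t c.1 + a.2) 1) =
        D.t (D.j (a.1 - (D.t c.1 + a.2)) - D.j 0) := by
      simp [form]
    change D.t (c.2 - D.t (D.tSubId.symm (D.j 0))) +
      -(D.form (Finsupp.single a.1 1) (Finsupp.single (D.t c.1 + a.2) 1)) =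
      D.t (c.2 - D.j (D.t c.1 + a.2 - a.1)) - D.t (D.tSubId.symm (D.j 0))
    have h2 : D.j 0 = D.t (D.tSubId.symm (D.j 0)) - D.tSubId.symm (D.j 0) := by
      rw [← tSubId_apply, LinearEquiv.apply_symm_apply]
    rw [hf, ← D.j_neg (a.1 - _), neg_sub]
    generalize D.j (D.t c.1 + a.2 - a.1) = w
    generalize D.tSubId.symm (D.j 0) = u at *
    rw [h2]
    simp only [map_sub]
    abel
  · change _ * (1 : D.T)⁻¹ = _
    simp [x']

theorem solution_x' (a c : A × A) :
    (LeftBrace.solution D.B').sigma (D.x' a) (D.x' c) = D.x' (D.square.sigma a c) := D.lam_x' a c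

theorem solution_gam_x' (a c : A × A) :
    (LeftBrace.solution D.B').gam (D.x' c) (D.x' a) = D.x' (D.square.gam c a) := by
  rw [YBSolution.gam_eq, Equiv.Perm.inv_eq_iff_eq, solution_x', solution_x', YBSolution.sigma_gam]

theorem sigma_bijOn (x : D.B') (hx : x ∈ D.X') :
    Set.BijOn ((LeftBrace.solution D.B').sigma x) D.X' D.X' := by
  obtain ⟨a, rfl⟩ := hx
  refine ⟨?_, (Equiv.injective _).injOn, ?_⟩
  · rintro _ ⟨c, rfl⟩
    exact ⟨_, (D.solution_x' a c).symm⟩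
  · rintro _ ⟨c, rfl⟩
    exact ⟨_, ⟨(D.square.sigma a)⁻¹ c, rfl⟩, by rw [solution_x']; simp⟩

theorem gam_bijOn (y : D.B') (hy : y ∈ D.X') :
    Set.BijOn ((LeftBrace.solution D.B').gam y) D.X' D.X' := by
  obtain ⟨c, rfl⟩ := hy
  refine ⟨?_, (Equiv.injective _).injOn, ?_⟩
  · rintro _ ⟨a, rfl⟩
    exact ⟨_, (D.solution_gam_x' a c).symm⟩
  · rintro _ ⟨a, rfl⟩
    exact ⟨_, ⟨(D.square.gam c)⁻¹ a, rfl⟩, by rw [solution_gam_x']; simp⟩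

/-- The restriction to `X'` of the solution associated to the left brace `B'`. -/
noncomputable def solution' : YBSolution D.X' :=
  (LeftBrace.solution D.B').restrict D.X' D.sigma_bijOn D.gam_bijOn

end SolutionData

/-! The proof rests on a criterion (`nonempty_permutationGroup_ringEquiv`) recognising the
permutation group of a solution on `X`. Let `B` be a left brace with a family `ι : X → B` generating
`(B, +)` and a faithful homomorphism `act` from `(B, ∘)` to `Sym_X` such that `λ_b (ι x) = ι (act b
x)` and `act (ι x) = σ_x`. Since `b + ι x = b ∘ ι ((act b)⁻¹ x)`, the family also generates `(B,
∘)`, so `act` maps `B` onto the permutation group; and since this formula describes the addition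
through `∘` and `act` alone, `act` carries it to the natural addition. The family `ι` need not be
injective, which matters because indicator functions can become equal modulo `H₁`.

The criterion is applied to `B = H'/H₁ ⋊_∘ A₁`. The lambda map of `(f, s)` in `B'` permutes `X'` and
involves `f` only through `b'(f, ·)`, so the resulting action on the parameters `A²` descends modulo
`H₁` (`act`, `lam_x'_eq_x'_act`). It is then faithful (`act_injective`): the first coordinate of
`A²` determines `s`, and the second determines all values `b'(f, e_a)`.

Coprimality gives additive generation (`closure_range_x'`): `n e_0 = 0` while `t^n` still generates
`T`, so a multiple of a single element of `X'` has `T`-component `t` and no `H'`-component. As `n >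
1`, the map `x'` is injective and identifies `(A², r)` with `(X', r')`, so one verification serves
both isomorphisms. -/

/-! ### Recognising the permutation group among left braces -/

namespace LeftBrace

variable {B : Type*} [LeftBrace B]

/-- Expresses the addition through multiplication and the lambda map; for `b` a generator on which
`λ` is known, this is the translation `shift` of a realization. -/
theorem add_eq_mul_lam_inv (a b : B) : a + b = a * lam a⁻¹ b := by
  rw [mul_eq, ← lam_mul, mul_inv_cancel, lam_one]

end LeftBrace

namespace YBSolution

variable {X : Type*} (S : YBSolution X) {B : Type*} [LeftBrace B] {ι : X → B}
  {act : B →* Equiv.Perm X}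

theorem lam_inv_act (hlam : ∀ b x, LeftBrace.lam b (ι x) = ι (act b x)) (b : B) (x : X) :
    LeftBrace.lam b⁻¹ (ι x) = ι ((act b)⁻¹ x) := by
  rw [hlam, map_inv]

/-- If the additive group of a left brace is generated by a set on which the left brace acts through
its lambda map, compatibly with a solution, then so is the multiplicative group. -/
theorem closure_eq_top_of_addSubgroup_closure (hact : ∀ x, act (ι x) = S.sigma x)
    (hlam : ∀ b x, LeftBrace.lam b (ι x) = ι (act b x))
    (hgen : AddSubgroup.closure (Set.range ι) = ⊤) : Subgroup.closure (Set.range ι) = ⊤ := by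
  rw [eq_top_iff]
  intro b _
  have hb : b ∈ AddSubgroup.closure (Set.range ι) := by rw [hgen]; trivial
  induction hb using AddSubgroup.closure_induction_right with
  | zero =>
    rw [LeftBrace.zero_eq_one]
    exact one_mem _
  | add_right b _ y hy ih =>
    obtain ⟨x, rfl⟩ := hy
    rw [LeftBrace.add_eq_mul_lam_inv, lam_inv_act hlam]
    exact mul_mem (ih trivial) (Subgroup.subset_closure ⟨_, rfl⟩)
  | add_neg_cancel b _ y hy ih =>
    obtain ⟨x, rfl⟩ := hy
    -- To subtract `ι x`, one looks for `v` with `b ∘ (ι v)⁻¹ + ι x = b`. The left side is `b ∘ (ι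
    -- v)⁻¹ ∘ ι (σ_v ((act b)⁻¹ x))`, so the condition is met once `σ_v⁻¹ v = (act b)⁻¹ x`, solvable
    -- because `v ↦ σ_v⁻¹ v` is bijective.
    obtain ⟨v, hv⟩ := S.diag.surjective ((act b)⁻¹ x)
    have h : b + -ι x = b * (ι v)⁻¹ := by
      rw [← sub_eq_add_neg, sub_eq_iff_eq_add, LeftBrace.add_eq_mul_lam_inv, lam_inv_act hlam,
        map_mul, mul_inv_rev, map_inv, inv_inv, Equiv.Perm.mul_apply, ← hv, hact, sigma_diag,
        inv_mul_cancel_right]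
    rw [h]
    exact mul_mem (ih trivial) (inv_mem (Subgroup.subset_closure ⟨_, rfl⟩))

/-- A left brace acting on `X` through its lambda map, compatibly with a solution on `X`, realizes
this solution. -/
def realizationOfLam (hact : ∀ x, act (ι x) = S.sigma x)
    (hlam : ∀ b x, LeftBrace.lam b (ι x) = ι (act b x))
    (hgen : AddSubgroup.closure (Set.range ι) = ⊤) : S.Realization B where
  ι := ι
  act := act
  act_ι := hact
  gen := S.closure_eq_top_of_addSubgroup_closure hact hlam hgen
  rel x y := by
    -- Both products equal `ι x + ι (σ_x y)`, because `σ_{σ_x y} (γ_y x) = x`.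
    rw [LeftBrace.mul_eq, LeftBrace.mul_eq, hlam, hlam, hact, hact, sigma_gam, add_comm]

/-- The natural addition attached to the realization is the given one: each `shift y` is the
additive translation by `ι y`, hence every element of `shifts` is an additive translation, and a
translation is determined by its value at `1 = 0`. -/
theorem realizationOfLam_transl (hact : ∀ x, act (ι x) = S.sigma x)
    (hlam : ∀ b x, LeftBrace.lam b (ι x) = ι (act b x))
    (hgen : AddSubgroup.closure (Set.range ι) = ⊤) (a b : B) :
    (S.realizationOfLam hact hlam hgen).transl a b = a + b := by
  set R := S.realizationOfLam hact hlam hgen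
  have key : ∀ τ ∈ R.shifts, ∃ c, ∀ h, τ h = c + h := by
    intro τ hτ
    induction hτ using Subgroup.closure_induction with
    | mem τ h =>
      obtain ⟨y, rfl⟩ := h
      refine ⟨ι y, fun h => ?_⟩
      rw [R.shift_apply, add_comm, LeftBrace.add_eq_mul_lam_inv, lam_inv_act hlam]
      rfl
    | one => exact ⟨0, fun h => by simp⟩
    | mul σ τ _ _ h1 h2 =>
      obtain ⟨c, hc⟩ := h1
      obtain ⟨d, hd⟩ := h2
      exact ⟨c + d, fun h => by rw [Equiv.Perm.mul_apply, hd, hc, add_assoc]⟩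
    | inv σ _ h =>
      obtain ⟨c, hc⟩ := h
      exact ⟨-c, fun h => by rw [Equiv.Perm.inv_eq_iff_eq, hc, add_neg_cancel_left]⟩
  obtain ⟨c, hc⟩ := key _ (R.transl_mem a)
  have h1 := hc 1
  rw [R.transl_one, ← LeftBrace.zero_eq_one, add_zero] at h1
  rw [hc, h1]

/-- A left brace `B` acting faithfully on `X` through its lambda map on a family of additive
generators, with the `x`-th generator acting as `σ_x`, is the permutation group of the solution. -/
theorem nonempty_permutationGroup_ringEquiv (hact : ∀ x, act (ι x) = S.sigma x)
    (hlam : ∀ b x, LeftBrace.lam b (ι x) = ι (act b x))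
    (hgen : AddSubgroup.closure (Set.range ι) = ⊤) (hinj : Injective act) :
    Nonempty (S.PermutationGroup ≃+* B) := by
  have hmem : ∀ b, act b ∈ Subgroup.closure (Set.range S.sigma) := by
    intro b
    have hb : b ∈ Subgroup.closure (Set.range ι) := by
      rw [S.closure_eq_top_of_addSubgroup_closure hact hlam hgen]; trivial
    induction hb using Subgroup.closure_induction with
    | mem b h =>
      obtain ⟨x, rfl⟩ := h
      exact Subgroup.subset_closure ⟨x, (hact x).symm⟩
    | one => rw [map_one]; exact one_mem _
    | mul a b _ _ ha hb => rw [map_mul]; exact mul_mem ha hb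
    | inv a _ ha => rw [map_inv]; exact inv_mem ha
  let f : B →* S.PermutationGroup := act.codRestrict (Subgroup.closure (Set.range S.sigma)) hmem
  have hfι : ∀ x, f (ι x) = PermutationGroup.of S x := fun x => Subtype.ext (hact x)
  have hbij : Bijective f := by
    refine ⟨fun a b h => hinj (congrArg Subtype.val h), ?_⟩
    rw [← MonoidHom.range_eq_top, eq_top_iff, ← S.permRealization.gen, Subgroup.closure_le]
    rintro _ ⟨x, rfl⟩
    exact ⟨_, hfι x⟩
  have hadd : ∀ a b, f (a + b) = f a + f b := by
    intro a b
    -- Both additions are now the natural ones of realizations of the same solution, and `f`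
    -- respects generators and actions.
    rw [← S.realizationOfLam_transl hact hlam hgen]
    exact (S.realizationOfLam hact hlam hgen).map_transl S.permRealization f hfι (fun _ => rfl) a b
  exact ⟨RingEquiv.symm { Equiv.ofBijective f hbij with
    map_mul' := f.map_mul
    map_add' := hadd }⟩

end YBSolution

/-! ### Passing to the quotient by the radical -/

namespace AsymmetricProduct

variable {H S : Type*} [AddCommGroup H] [LeftBrace S] {D : AsymmetricDatum H S}

variable (D) in
/-- The first projection, as an additive homomorphism. -/
def fstHom : AsymmetricProduct D →+ H where
  toFun := fst
  map_zero' := rfl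
  map_add' _ _ := rfl

variable (D) in
/-- The additive homomorphism onto the asymmetric product modulo the radical. -/
def toModRadical : AsymmetricProduct D →+ AsymmetricProduct D.modRadical where
  toFun p := ⟨p.fst, p.snd⟩
  map_zero' := rfl
  map_add' _ _ := rfl

theorem toModRadical_surjective : Surjective (toModRadical D) := by
  rintro ⟨F, s⟩
  obtain ⟨f, rfl⟩ := QuotientAddGroup.mk_surjective F
  exact ⟨⟨f, s⟩, rfl⟩

theorem toModRadical_mul (p q : AsymmetricProduct D) :
    toModRadical D (p * q) = toModRadical D p * toModRadical D q := rfl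

theorem toModRadical_lam (p q : AsymmetricProduct D) :
    toModRadical D (LeftBrace.lam p q) =
      LeftBrace.lam (toModRadical D p) (toModRadical D q) := by
  rw [LeftBrace.lam, LeftBrace.lam, map_add, map_neg, toModRadical_mul]

end AsymmetricProduct

/-! ### Additive generation of the asymmetric product -/

namespace SolutionData

variable {A : Type*} [AddCommGroup A] (D : SolutionData A)

attribute [local instance] exponentModule

/-- For `n > 1` one has `1 ≠ 0` in `ℤ/(n)`, so distinct points have distinct indicator functions. -/
theorem x'_injective (hn : 1 < AddMonoid.exponent A) : Injective D.x' := by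
  have : Fact (1 < AddMonoid.exponent A) := ⟨hn⟩
  rintro ⟨a, c⟩ ⟨a', c'⟩ h
  have h1 := congrArg AsymmetricProduct.fst h
  have h2 := congrArg (fun p => p.snd.fst) h
  ext
  · exact Finsupp.single_left_injective one_ne_zero h1
  · exact sub_left_injective h2

/-- The element `t` of `T`. -/
def tT : D.T := ⟨D.t, Subgroup.mem_zpowers D.t⟩

/-- The projection `B' → T`, as a homomorphism on the additive group. -/
noncomputable def sndHom : D.B' →+ Additive D.T where
  toFun p := Additive.ofMul p.snd.snd
  map_zero' := rfl
  map_add' p q := by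
    change p.snd.snd * q.snd.snd * 1 = p.snd.snd * q.snd.snd
    rw [mul_one]

/-- Differences of generators give `A`, coprimality isolates `t` from the `H'`-component, and
indicator functions cover `H'`. The values of `b'` that appear when summing lie in `A`, so they can
be corrected at each stage. -/
theorem closure_range_x' (ht : (orderOf D.t).Coprime (AddMonoid.exponent A)) :
    AddSubgroup.closure (Set.range D.x') = ⊤ := by
  set K := AddSubgroup.closure (Set.range D.x')
  have hx : ∀ a c, (⟨Finsupp.single a 1, ⟨c, D.tT⟩⟩ : D.B') ∈ K := by
    intro a c
    -- The second index is arbitrary, so the constant subtracted in `x'` can be absorbed into it.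
    refine AddSubgroup.subset_closure ⟨(a, c + D.t (D.tSubId.symm (D.j 0))), ?_⟩
    simp only [x', add_sub_cancel_right]
    rfl
  have hA : ∀ c, (⟨0, ⟨c, 1⟩⟩ : D.B') ∈ K := by
    intro c
    have e : (⟨0, ⟨c, 1⟩⟩ : D.B') =
        ⟨Finsupp.single 0 1, ⟨c, D.tT⟩⟩ - ⟨Finsupp.single 0 1, ⟨0, D.tT⟩⟩ := by
      rw [eq_sub_iff_add_eq]
      refine AsymmetricProduct.ext ?_ (SemidirectBrace.ext ?_ ?_) <;> simp
    rw [e]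
    exact sub_mem (hx _ _) (hx _ _)
  -- Once `A` lies in `K`, the `A`-coordinate of an element without `H'`-component is irrelevant to
  -- membership.
  have hsub : ∀ c c' τ, (⟨0, ⟨c, τ⟩⟩ : D.B') ∈ K → (⟨0, ⟨c', τ⟩⟩ : D.B') ∈ K := by
    intro c c' τ h
    have e : (⟨0, ⟨c', τ⟩⟩ : D.B') = ⟨0, ⟨c, τ⟩⟩ + ⟨0, ⟨c' - c, 1⟩⟩ := by
      refine AsymmetricProduct.ext ?_ (SemidirectBrace.ext ?_ ?_) <;> simp
    rw [e]
    exact add_mem h (hA _)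
  have hT : ∀ c, (⟨0, ⟨c, D.tT⟩⟩ : D.B') ∈ K := by
    have ho : (AddMonoid.exponent A).Coprime (orderOf D.tT) := by
      rw [← Subgroup.orderOf_coe]
      exact ht.symm
    -- Here `(t^n)^m = t`, where `n` is the exponent of `A`.
    obtain ⟨m, hm⟩ := exists_pow_eq_self_of_coprime ho
    intro c
    set N := AddMonoid.exponent A
    set p : D.B' := m • N • ⟨Finsupp.single 0 1, ⟨0, D.tT⟩⟩ with hp
    have hpK : p ∈ K := nsmul_mem (nsmul_mem (hx _ _) _) _
    have h1 : p.fst = 0 := by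
      change AsymmetricProduct.fstHom _ p = 0
      rw [hp, map_nsmul, map_nsmul]
      change m • N • (Finsupp.single 0 1 : H' A) = 0
      rw [Finsupp.smul_single, nsmul_one]
      simp [N]
    have h2 : p.snd.snd = D.tT := by
      have h : D.sndHom p = Additive.ofMul D.tT := by
        rw [hp, map_nsmul, map_nsmul]
        exact congrArg Additive.ofMul hm
      exact Additive.ofMul.injective h
    -- The `A`-coordinate of the multiple collects values of the bilinear form and need not be
    -- computed.
    refine hsub p.snd.fst c _ ?_
    convert hpK using 1
    exact AsymmetricProduct.ext h1.symm (SemidirectBrace.ext rfl h2.symm)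
  have hS : ∀ s, (⟨0, s⟩ : D.B') ∈ K := by
    rintro ⟨c, τ⟩
    obtain ⟨z, hz⟩ := Subgroup.mem_zpowers_iff.1 τ.2
    have hz' : τ = D.tT ^ z := Subtype.ext (by simp [tT, hz])
    have h1 : (z • (⟨0, ⟨0, D.tT⟩⟩ : D.B')).fst = 0 := by
      change AsymmetricProduct.fstHom _ _ = 0
      rw [map_zsmul]
      exact smul_zero z
    have h2 : (z • (⟨0, ⟨0, D.tT⟩⟩ : D.B')).snd.snd = τ := by
      have h : D.sndHom (z • (⟨0, ⟨0, D.tT⟩⟩ : D.B')) = Additive.ofMul τ := by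
        rw [map_zsmul, hz']
        rfl
      exact Additive.ofMul.injective h
    refine hsub (z • (⟨0, ⟨0, D.tT⟩⟩ : D.B')).snd.fst c _ ?_
    convert zsmul_mem (hT 0) z using 1
    exact AsymmetricProduct.ext h1.symm (SemidirectBrace.ext rfl h2.symm)
  -- Only the projection of `K` to `H'` is treated: the `e_a` generate `H'` over `ℤ`, as `ℤ/(n)` is
  -- a quotient of `ℤ`.
  have hf : K.map (AsymmetricProduct.fstHom D.datum) = ⊤ := by
    rw [eq_top_iff]
    intro f _
    induction f using Finsupp.induction_linear with
    | zero => exact zero_mem _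
    | add f g hf hg => exact add_mem (hf trivial) (hg trivial)
    | single a m =>
      have h1 : Finsupp.single a (1 : ZMod (AddMonoid.exponent A)) ∈
          K.map (AsymmetricProduct.fstHom D.datum) := ⟨_, hx a 0, rfl⟩
      obtain ⟨z, rfl⟩ := ZMod.intCast_surjective m
      have h2 := zsmul_mem h1 z
      rwa [Finsupp.smul_single, zsmul_one] at h2
  rw [eq_top_iff]
  rintro ⟨f, s⟩ _
  have hfK : f ∈ K.map (AsymmetricProduct.fstHom D.datum) := by rw [hf]; trivial
  obtain ⟨⟨_, u⟩, hK, rfl⟩ := hfK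
  -- The element added has zero `H'`-component, so `b'` contributes nothing and the `A₁`-component
  -- is corrected from `u` to `s`.
  have h := add_mem hK (hS (s - u))
  convert h using 1
  refine AsymmetricProduct.ext ?_ ?_ <;> simp [AsymmetricProduct.fstHom]

/-! ### The faithful action on `A²` -/

/-- The class of the indicator function of `{a}` modulo the radical. -/
noncomputable def indicatorClass (a : A) : H' A ⧸ D.datum.radical :=
  (Finsupp.single a 1 : H' A)

theorem modRadical_α_indicatorClass (s : D.A₁) (a : A) :
    D.datum.modRadical.α s (D.indicatorClass a) = D.indicatorClass ((D.g s).symm a) := by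
  rw [indicatorClass, AsymmetricDatum.modRadical_α]
  change ((D.α' s _ : H' A) : H' A ⧸ D.datum.radical) = _
  rw [α'_eq, Finsupp.equivMapDomain_single]
  rfl

/-- The map on `A²` corresponding to the lambda map of an element of `(H' A ⧸ H₁) ⋊_∘ A₁`. -/
noncomputable def actFun (p : AsymmetricProduct D.datum.modRadical) (c : A × A) : A × A :=
  -- The constant `t(t - id)⁻¹(j_0)` is subtracted from the second parameter in `x'`; it is removed
  -- before `τ` is applied and restored afterwards.
  ((D.g p.snd).symm c.1,
    D.t (D.tSubId.symm (D.j 0)) +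
      (p.snd.snd : A ≃ₗ[ℤ] A) (c.2 - D.t (D.tSubId.symm (D.j 0))) -
      (D.datum.modRadical.b p.fst (D.indicatorClass ((D.g p.snd).symm c.1))).fst)

/-- The action of `(H' A ⧸ H₁) ⋊_∘ A₁` on `A²`. -/
noncomputable def act : AsymmetricProduct D.datum.modRadical →* Equiv.Perm (A × A) :=
  MonoidHom.toHomPerm
    { toFun := D.actFun
      map_one' := by
        funext c
        change D.actFun 1 c = c
        simp [actFun, g_symm_one]
      map_mul' := by
        intro p q
        funext c
        change D.actFun (p * q) c = D.actFun p (D.actFun q c)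
        -- Equivariance moves the action of `p` inside the form coming from `q`, giving the second
        -- summand of the form for `p * q`.
        have h := D.datum.modRadical.equivariant p.snd q.fst
          (D.indicatorClass ((D.g q.snd).symm c.1))
        rw [modRadical_α_indicatorClass, SemidirectBrace.lam_eq] at h
        have h1 := congrArg SemidirectBrace.fst h
        simp only [actFun, AsymmetricProduct.mul_fst, AsymmetricProduct.mul_snd, g_symm_mul,
          Equiv.trans_apply, map_add, AddMonoidHom.add_apply, SemidirectBrace.add_fst, ← h1]
        ext
        · rfl
        · simp only [SemidirectBrace.mul_snd, Subgroup.coe_mul, LinearEquiv.mul_apply, map_sub,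
            map_add, Subgroup.subtype_apply]
          abel }

theorem act_apply (p : AsymmetricProduct D.datum.modRadical) (c : A × A) :
    D.act p c = D.actFun p c := rfl

/-- Links the explicit action to the lambda map of `B'`, and shows that the latter depends on the
`H'`-component only modulo the radical. -/
theorem lam_x'_eq_x'_act (p : D.B') (c : A × A) :
    LeftBrace.lam p (D.x' c) = D.x' (D.act (AsymmetricProduct.toModRadical D.datum p) c) := by
  rw [AsymmetricProduct.lam_eq, act_apply]
  have hα : D.datum.α p.snd (D.x' c).fst = Finsupp.single ((D.g p.snd).symm c.1) 1 := by
    change D.α' p.snd (Finsupp.single c.1 1) = _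
    rw [α'_eq, Finsupp.equivMapDomain_single]
  rw [hα]
  refine AsymmetricProduct.ext rfl ?_
  rw [SemidirectBrace.lam_eq, sub_eq_add_neg]
  refine SemidirectBrace.ext ?_ ?_
  · change (p.snd.snd : A ≃ₗ[ℤ] A) (c.2 - D.t (D.tSubId.symm (D.j 0))) +
      -(D.datum.b p.fst (Finsupp.single ((D.g p.snd).symm c.1) 1)).fst =
      D.t (D.tSubId.symm (D.j 0)) + (p.snd.snd : A ≃ₗ[ℤ] A) (c.2 - D.t (D.tSubId.symm (D.j 0))) -
      (D.datum.b p.fst (Finsupp.single ((D.g p.snd).symm c.1) 1)).fst -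
      D.t (D.tSubId.symm (D.j 0))
    abel
  · change D.tT * (1 : D.T)⁻¹ = D.tT
    simp

/-- On first coordinates the action is the affine map `a ↦ τ a + d + offset τ`. If it is the
identity, its value at `0` gives `d + offset τ = 0`, whence `τ = 1` and `d = 0`. What remains on
second coordinates is subtraction of the form of `f` with `e_a`, so triviality puts `f` in the
radical. -/
theorem act_injective : Injective D.act := by
  rw [injective_iff_map_eq_one]
  rintro ⟨F, d, τ⟩ h
  obtain ⟨f, rfl⟩ := QuotientAddGroup.mk_surjective F
  have hc : ∀ c, D.actFun ⟨f, d, τ⟩ c = c := fun c => congrArg (fun e => e c) h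
  have h1 : ∀ a, (τ : A ≃ₗ[ℤ] A) a + d + D.offset τ = a := fun a => congrArg Prod.fst (hc (a, 0))
  have h0 : d + D.offset τ = 0 := by simpa using h1 0
  obtain rfl : τ = 1 := by
    ext a
    have := h1 a
    rw [add_assoc, h0, add_zero] at this
    exact this
  obtain rfl : d = 0 := by rwa [offset_one, add_zero] at h0
  have h2 : ∀ a, D.form f (Finsupp.single a 1) = 0 := by
    intro a
    have h3 := congrArg Prod.snd (hc (a, 0))
    have h4 : (D.g ⟨0, 1⟩).symm a = a := h1 a
    change D.t (D.tSubId.symm (D.j 0)) + (0 - D.t (D.tSubId.symm (D.j 0))) -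
      D.form f (Finsupp.single ((D.g ⟨0, 1⟩).symm a) 1) = 0 at h3
    rw [h4] at h3
    simpa using h3
  -- Pairing to zero with every `e_a` suffices, since these generate `H'` additively.
  have hf : f ∈ D.datum.radical := by
    intro h
    induction h using Finsupp.induction_linear with
    | zero => exact map_zero _
    | add g h hg hh => rw [map_add, hg, hh, add_zero]
    | single a m =>
      obtain ⟨z, rfl⟩ := ZMod.intCast_surjective m
      have e : (Finsupp.single a (z : ZMod (AddMonoid.exponent A)) : H' A) =
          z • Finsupp.single a 1 := by rw [Finsupp.smul_single, zsmul_one]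
      have h0 : D.datum.b f (Finsupp.single a 1) = 0 := SemidirectBrace.ext (h2 a) rfl
      rw [e, map_zsmul, h0, smul_zero]
  exact AsymmetricProduct.ext ((QuotientAddGroup.eq_zero_iff f).2 hf) rfl

/-! ### Verifying the criterion for both solutions -/

/-- The image of `x' a` in the asymmetric product modulo the radical. -/
noncomputable def xBar (a : A × A) : AsymmetricProduct D.datum.modRadical :=
  AsymmetricProduct.toModRadical D.datum (D.x' a)

/-- Both sides describe `λ_{x' a}` on `X'`, and injectivity of `x'` lets them be compared on `A²`.
-/
theorem act_xBar (hn : 1 < AddMonoid.exponent A) (a : A × A) :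
    D.act (D.xBar a) = D.square.sigma a := by
  ext1 c
  apply D.x'_injective hn
  rw [xBar, ← lam_x'_eq_x'_act, lam_x']
  rfl

/-- Every element of the quotient lifts to `B'`, where the formula is already known. -/
theorem lam_xBar (p : AsymmetricProduct D.datum.modRadical) (c : A × A) :
    LeftBrace.lam p (D.xBar c) = D.xBar (D.act p c) := by
  obtain ⟨p, rfl⟩ := AsymmetricProduct.toModRadical_surjective p
  rw [xBar, ← AsymmetricProduct.toModRadical_lam, lam_x'_eq_x'_act]
  rfl

theorem closure_range_xBar (ht : (orderOf D.t).Coprime (AddMonoid.exponent A)) :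
    AddSubgroup.closure (Set.range D.xBar) = ⊤ := by
  have h := congrArg (AddSubgroup.map (AsymmetricProduct.toModRadical D.datum))
    (D.closure_range_x' ht)
  rw [AddMonoidHom.map_closure, ← Set.range_comp, ← AddMonoidHom.range_eq_map,
    AddMonoidHom.range_eq_top.2 AsymmetricProduct.toModRadical_surjective] at h
  exact h

/-- The bijection from `A²` to `X'`. -/
noncomputable def equivX' (hn : 1 < AddMonoid.exponent A) : A × A ≃ D.X' :=
  Equiv.ofInjective D.x' (D.x'_injective hn)

theorem solution'_sigma (hn : 1 < AddMonoid.exponent A) (a c : A × A) :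
    D.solution'.sigma (D.equivX' hn a) (D.equivX' hn c) = D.equivX' hn (D.square.sigma a c) :=
  Subtype.ext (D.solution_x' a c)

end SolutionData

/-- Finiteness is encoded in the two hypotheses: `AddMonoid.exponent` is `0` for infinite exponent,
which `hn` excludes; `orderOf` is `0` for infinite order, and `0` is not coprime to an integer
greater than `1`. -/
theorem theorem4p5 {A : Type*} [AddCommGroup A] (D : SolutionData A)
    (hn : 1 < AddMonoid.exponent A) (ht : (orderOf D.t).Coprime (AddMonoid.exponent A)) :
    Nonempty (D.solution'.PermutationGroup ≃+* AsymmetricProduct D.datum.modRadical) ∧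
    Nonempty (D.square.PermutationGroup ≃+* AsymmetricProduct D.datum.modRadical) := by
  refine ⟨?_, D.square.nonempty_permutationGroup_ringEquiv (D.act_xBar hn) D.lam_xBar
    (D.closure_range_xBar ht) D.act_injective⟩
  let e := D.equivX' hn
  -- The same brace and family are used for `X'`, with the action conjugated by the bijection `A² ≃
  -- X'`.
  refine D.solution'.nonempty_permutationGroup_ringEquiv (ι := D.xBar ∘ e.symm)
    (act := e.permCongrHom.toMonoidHom.comp D.act) ?_ ?_ ?_
    (e.permCongrHom.injective.comp D.act_injective)
  · intro x
    obtain ⟨a, rfl⟩ := e.surjective x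
    ext1 y
    obtain ⟨c, rfl⟩ := e.surjective y
    change e (D.act (D.xBar (e.symm (e a))) (e.symm (e c))) = _
    rw [e.symm_apply_apply, e.symm_apply_apply, D.act_xBar hn, D.solution'_sigma hn]
  · intro p x
    obtain ⟨c, rfl⟩ := e.surjective x
    change LeftBrace.lam p (D.xBar (e.symm (e c))) =
      D.xBar (e.symm (e (D.act p (e.symm (e c)))))
    rw [e.symm_apply_apply, e.symm_apply_apply, D.lam_xBar]
  · rw [e.symm.surjective.range_comp]
    exact D.closure_range_xBar ht
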